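/- Fix an integer $k \ge 0$ and a sequence $p = p(n) \in [0,1]$. Let $G(n,p)$ be the random graph on the vertex set $\{1,\dots,n\}$ in which each edge is inserted independently with probability $p(n)$, and let $X(n,p)$ be its clique complex, i.e. the simplicial complex whose faces are the (vertex sets of) complete subgraphs of $G(n,p)$. A property holds *almost always* if its probability tends to $1$ as $n \to \infty$. The octahedral $k$-sphere is the join of $k+1$ pairs of isolated points $\{u_i, v_i\}$, $1 \le i \le k+1$: its faces are the nonempty sets of these $2(k+1)$ vertices that contain no pair $\{u_i,v_i\}$; its geometric realization is homeomorphic to the unit sphere $\mathbb{S}^k \subset \mathbb{R}^{k+1}$. **Theorem.** Suppose that $p^{k+1} n \to 0$ and $p^k n \to \infty$ as $n \to \infty$. Then: 1. Almost always $X(n,p)$ retracts simplicially onto an induced octahedral $k$-sphere. That is, almost always there are an induced subcomplex $L$ of $X(n,p)$ isomorphic to the octahedral $k$-sphere and a map $r$ of vertices that sends every face of $X(n,p)$ to a face of $L$ and fixes every vertex of $L$. In particular the geometric realization $|L|$ is homeomorphic to $\mathbb{S}^k$, and the affine extension of $r$ is a continuous retraction of the geometric realization of $X(n,p)$ onto $|L|$.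 2. Consequently, almost always the reduced simplicial homology group $\widetilde{H}_k(X(n,p),\mathbb{Z})$ has a direct summand isomorphic to $\mathbb{Z}$. -/

import Mathlib

open Filter Topology MeasureTheory

/-- The clique complex of a graph: its faces are the nonempty finite cliques. -/
def SimpleGraph.cliqueComplex {V : Type*} (G : SimpleGraph V) :
    PreAbstractSimplicialComplex V where
  faces := {s | s.Nonempty ∧ G.IsClique (s : Set V)}
  isRelLowerSet_faces := fun _ hs =>
    ⟨hs.1, fun _ hts ht => ⟨ht, hs.2.subset (Finset.coe_subset.mpr hts)⟩⟩

/-- `G(n, p n)` almost always has the property `P`: its probability tends to `1`. -/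
def AlmostAlways (p : ℕ → unitInterval) (P : ∀ n : ℕ, SimpleGraph (Fin n) → Prop) : Prop :=
  Tendsto (fun n : ℕ => SimpleGraph.binomialRandom (Fin n) (p n) {G | P n G}) atTop (𝓝 1)

/-- The octahedral `k`-sphere, the join of `k + 1` pairs of isolated points `(i, 0), (i, 1)`:
a nonempty set of vertices is a face iff it contains no pair `(i, 0), (i, 1)`. -/
def octahedralSphere (k : ℕ) : PreAbstractSimplicialComplex (Fin (k + 1) × Fin 2) where
  faces := {s | s.Nonempty ∧ ∀ i, ¬ ((i, 0) ∈ s ∧ (i, 1) ∈ s)}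
  isRelLowerSet_faces := fun _ hs =>
    ⟨hs.1, fun _ hts ht => ⟨ht, fun i hi => hs.2 i ⟨hts hi.1, hts hi.2⟩⟩⟩

namespace PreAbstractSimplicialComplex

/-- The subcomplex induced on a set `S` of vertices: all faces with vertices in `S`. -/
def induced {V : Type*} (K : PreAbstractSimplicialComplex V) (S : Set V) :
    PreAbstractSimplicialComplex V where
  faces := {s | s ∈ K.faces ∧ (s : Set V) ⊆ S}
  isRelLowerSet_faces := fun _ hs =>
    ⟨(K.isRelLowerSet_faces hs.1).1, fun _ hts ht =>
      ⟨(K.isRelLowerSet_faces hs.1).2 hts ht, (Finset.coe_subset.mpr hts).trans hs.2⟩⟩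

/-- `L` is an induced subcomplex of `K` that is isomorphic to the octahedral `k`-sphere. -/
def IsInducedOctahedralSphere {V : Type*} [DecidableEq V]
    (K L : PreAbstractSimplicialComplex V) (k : ℕ) : Prop :=
  ∃ e : Fin (k + 1) × Fin 2 ↪ V,
    L = (octahedralSphere k).map e ∧ L = K.induced (Set.range e)

/-- `r` is, on vertices, a simplicial retraction of `K` onto its subcomplex `L`: it maps faces of
`K` to faces of `L` and fixes the vertices of `L`. -/
structure IsSimplicialRetraction {V : Type*} [DecidableEq V]
    (K L : PreAbstractSimplicialComplex V) (r : V → V) : Prop where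
  le : L ≤ K
  image_mem : ∀ s ∈ K.faces, s.image r ∈ L.faces
  apply_eq : ∀ v : V, {v} ∈ L.faces → r v = v

/-- The geometric realization of `K` in barycentric coordinates, as a subspace of `ℝ^V`. -/
def realization {V : Type*} [Fintype V] (K : PreAbstractSimplicialComplex V) : Set (V → ℝ) :=
  {x | (∀ v, 0 ≤ x v) ∧ ∑ v, x v = 1 ∧ ∃ s ∈ K.faces, {v | x v ≠ 0} = (s : Set V)}

/-- The affine extension, in barycentric coordinates, of a map of vertices. -/
def affineExtension {V : Type*} [Fintype V] [DecidableEq V] (r : V → V) (x : V → ℝ) : V → ℝ :=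
  fun w => ∑ v with r v = w, x v

/-- `K` retracts simplicially onto an induced octahedral `k`-sphere `L`. The realization of `L` is
homeomorphic to the unit sphere of `ℝ^(k+1)`, and the affine extension of the simplicial
retraction is a (continuous) retraction of the realization of `K` onto that of `L`. -/
def RetractsOntoOctahedralSphere {V : Type*} [Fintype V] [DecidableEq V]
    (K : PreAbstractSimplicialComplex V) (k : ℕ) : Prop :=
  ∃ (L : PreAbstractSimplicialComplex V) (r : V → V),
    K.IsInducedOctahedralSphere L k ∧ K.IsSimplicialRetraction L r ∧
    Nonempty (L.realization ≃ₜ Metric.sphere (0 : EuclideanSpace ℝ (Fin (k + 1))) 1) ∧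
    ∃ ρ : C(K.realization, L.realization),
      (∀ x, (ρ x : V → ℝ) = affineExtension r x) ∧
      ∀ x : K.realization, (x : V → ℝ) ∈ L.realization → (ρ x : V → ℝ) = x

section Homology

variable {V : Type*} [LinearOrder V] (K : PreAbstractSimplicialComplex V)

/-- The faces of `K` with `m` vertices (that is, of dimension `m - 1`), the empty face being
counted as the only face of dimension `-1`. -/
def AugFace (m : ℕ) : Type _ := {s : Finset V // s.card = m ∧ (s = ∅ ∨ s ∈ K.faces)}

/-- Deleting a vertex of a face. -/
def AugFace.erase {K : PreAbstractSimplicialComplex V} {m : ℕ} (s : K.AugFace (m + 1))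
    (v : {v // v ∈ s.1}) : K.AugFace m :=
  ⟨s.1.erase v, by
    have h := s.2.1
    rw [Finset.card_erase_of_mem v.2]; omega, by
    rcases Finset.eq_empty_or_nonempty (s.1.erase v) with h | h
    · exact Or.inl h
    · rcases s.2.2 with h0 | h0
      · exact absurd v.2 (by simp [h0])
      · exact Or.inr ((K.isRelLowerSet_faces h0).2 (Finset.erase_subset _ _) h)⟩

/-- The group of integral simplicial chains of dimension `m - 1` in the augmented simplicial chain
complex, each face being oriented by the order of its vertices. -/
abbrev AugChain (m : ℕ) : Type _ := K.AugFace m →₀ ℤ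

/-- The boundary of the face `v₀ < ⋯ < v_m` is `∑ i, (-1)^i [v₀, …, v̂ᵢ, …, v_m]`; here `i` is the
number of vertices of the face below `vᵢ`. For `m = 0` this is the augmentation. -/
noncomputable def boundary (m : ℕ) : K.AugChain (m + 1) →ₗ[ℤ] K.AugChain m :=
  Finsupp.linearCombination ℤ fun s : K.AugFace (m + 1) =>
    ∑ v : {v // v ∈ s.1}, Finsupp.single (s.erase v) ((-1 : ℤ) ^ (s.1.filter (· < v.1)).card)

theorem sign_add_sign {s : Finset V} {v w : V} (hv : v ∈ s) (hvw : v < w) :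
    (-1 : ℤ) ^ ((s.erase v).filter (· < w)).card * (-1) ^ (s.filter (· < v)).card +
      (-1) ^ ((s.erase w).filter (· < v)).card * (-1) ^ (s.filter (· < w)).card = 0 := by
  have h1 : (s.erase w).filter (· < v) = s.filter (· < v) := by
    ext x
    simp only [Finset.mem_filter, Finset.mem_erase]
    constructor
    · exact fun h => ⟨h.1.2, h.2⟩
    · exact fun h => ⟨⟨(h.2.trans hvw).ne, h.1⟩, h.2⟩
  have h2 : (s.filter (· < w)).card = ((s.erase v).filter (· < w)).card + 1 := by
    rw [Finset.filter_erase, Finset.card_erase_add_one]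
    simp [hv, hvw]
  rw [h1, h2]
  ring

/-- The boundary of a boundary vanishes. -/
theorem boundary_boundary (m : ℕ) (c : K.AugChain (m + 2)) :
    K.boundary m (K.boundary (m + 1) c) = 0 := by
  induction c using Finsupp.induction_linear with
  | zero => simp
  | add f g hf hg => simp [hf, hg]
  | single s a =>
    simp only [boundary, Finsupp.linearCombination_single, map_smul, map_sum]
    rw [Finset.sum_congr rfl fun v _ => by rw [Finset.smul_sum], Finset.sum_sigma']
    convert smul_zero a
    refine Finset.sum_involution
      (fun x _ => ⟨⟨x.2.1, Finset.mem_of_mem_erase x.2.2⟩,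
        ⟨x.1.1, Finset.mem_erase.mpr ⟨(Finset.ne_of_mem_erase x.2.2).symm, x.1.2⟩⟩⟩) ?_ ?_ ?_ ?_
    · rintro ⟨⟨v, hv⟩, ⟨w, hw⟩⟩ -
      have hne : w ≠ v := Finset.ne_of_mem_erase hw
      have hws : w ∈ s.1 := Finset.mem_of_mem_erase hw
      have he : ((s.erase ⟨w, hws⟩).erase
          ⟨v, Finset.mem_erase.mpr ⟨hne.symm, hv⟩⟩ : K.AugFace m) =
          (s.erase ⟨v, hv⟩).erase ⟨w, hw⟩ :=
        Subtype.ext (Finset.erase_right_comm)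
      simp only [Finsupp.smul_single, smul_eq_mul]
      rw [he, ← Finsupp.single_add]
      refine (congrArg _ ?_).trans (Finsupp.single_zero _)
      rcases lt_or_gt_of_ne hne with h | h
      · have := sign_add_sign hws h
        simp only [AugFace.erase]
        linarith
      · have := sign_add_sign hv h
        simp only [AugFace.erase]
        linarith
    · rintro ⟨⟨v, hv⟩, ⟨w, hw⟩⟩ - - h
      have := congrArg (fun x => x.1.1) h
      exact Finset.ne_of_mem_erase hw this
    · intros
      exact Finset.mem_univ _
    · intros
      rfl

/-- The reduced simplicial homology group `H̃_k(K, ℤ)`: `k`-cycles modulo `k`-boundaries of the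
augmented simplicial chain complex. -/
abbrev ReducedHomology (k : ℕ) : Type _ :=
  LinearMap.ker (K.boundary k) ⧸
    (LinearMap.range (K.boundary (k + 1))).submoduleOf (LinearMap.ker (K.boundary k))

end Homology

end PreAbstractSimplicialComplex

/-- The abelian group `H` has a direct summand isomorphic to `ℤ`. -/
def HasIntSummand (H : Type*) [AddCommGroup H] : Prop :=
  ∃ A B : AddSubgroup H, IsCompl A B ∧ Nonempty (A ≃+ ℤ)

/-!
Consider an induced octahedral sphere in the clique complex, with antipodal pairs `uᵢ, vᵢ`, such
that no outside vertex is adjacent to all vertices of a facet. Then every outside vertex has no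
neighbour in some pair, and sending it to `uᵢ` for such a pair `i` is a simplicial retraction
(`IsConeFreeOctahedron.exists_isSimplicialRetraction`).

Such a sphere exists almost always by the second moment method
(`one_sub_le_measureReal_iUnion_diff`). The octahedral graph has average degree at most `2k` on
each set of its vertices, so two copies with `j` common vertices share at most `k j` edges, and the
second moment of the number of copies is at most `(1 + O(1 / (n p ^ k))) ^ (2k + 2)` times the
square of the mean. As `p ^ k n → ∞`, the number of copies is concentrated. On the other hand, a
given copy has an edge inside an antipodal pair with probability at most `(k + 1) p`, and a cone
over a facet with probability at most `2 ^ (k + 1) p ^ (k + 1) n`. As `p ^ (k + 1) n → 0`, only a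
vanishing proportion of the copies is spoilt in this way.

The summand of the homology splits off because the pairing of a cycle with a cocycle is `1`. Both
are given by determinants. The cycle is the boundary of the cross-polytope, whose coefficient at
a simplex is the determinant of its vertices in `ℤ^(k+1)`; expanding the determinants shows that
its boundary involves only the sum of all vertices of the cross-polytope, which is `0`. The cocycle
is the pullback along the retraction of the cochain dual to the facet `u₀, …, u_k`. Its coboundary
at a simplex with `k + 2` vertices is a determinant with two equal rows, because the retraction
maps these vertices to at most `k + 1` vertices.
-/

namespace PreAbstractSimplicialComplex

/-! ### Simplicial retractions and realizations -/

theorem IsSimplicialRetraction.affineExtension_eq_self {V : Type*} [Fintype V] [DecidableEq V]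
    {K L : PreAbstractSimplicialComplex V} {r : V → V} (h : K.IsSimplicialRetraction L r)
    {x : V → ℝ} (hx : x ∈ L.realization) : affineExtension r x = x := by
  obtain ⟨-, -, s, hs, hsupp⟩ := hx
  have hfix : ∀ v, x v ≠ 0 → r v = v := fun v hv => by
    have hvs : v ∈ s := by
      have : v ∈ {v | x v ≠ 0} := hv
      rw [hsupp] at this
      exact this
    exact h.apply_eq v
      ((L.isRelLowerSet_faces hs).2 (Finset.singleton_subset_iff.mpr hvs) (by simp))
  funext w
  rw [affineExtension, Finset.sum_filter, Finset.sum_eq_single w]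
  · split_ifs with hw
    · rfl
    · by_contra h0
      exact hw (hfix w fun h1 => h0 h1.symm)
  · intro v _ hvw
    split_ifs with hv
    · by_contra h0
      exact hvw ((hfix v h0).symm.trans hv)
    · rfl
  · simp

theorem IsSimplicialRetraction.affineExtension_mem {V : Type*} [Fintype V] [DecidableEq V]
    {K L : PreAbstractSimplicialComplex V} {r : V → V} (h : K.IsSimplicialRetraction L r)
    {x : V → ℝ} (hx : x ∈ K.realization) : affineExtension r x ∈ L.realization := by
  obtain ⟨hx0, hx1, s, hs, hsupp⟩ := hx
  refine ⟨fun w => Finset.sum_nonneg fun v _ => hx0 v, ?_, s.image r, h.image_mem s hs, ?_⟩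
  · rw [← hx1]
    exact Finset.sum_fiberwise _ _ _
  · ext w
    have hmem : ∀ v, v ∈ s ↔ x v ≠ 0 := fun v => by
      rw [← Finset.mem_coe, ← hsupp]; rfl
    simp only [Set.mem_ofPred_eq, Finset.coe_image, Set.mem_image, Finset.mem_coe, affineExtension]
    rw [Ne, Finset.sum_eq_zero_iff_of_nonneg fun v _ => hx0 v]
    simp only [Finset.mem_filter, Finset.mem_univ, true_and, not_forall, hmem]
    exact ⟨fun ⟨v, h1, h2⟩ => ⟨v, h2, h1⟩, fun ⟨v, h1, h2⟩ => ⟨v, h2, h1⟩⟩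

theorem IsSimplicialRetraction.exists_continuousMap {V : Type*} [Fintype V] [DecidableEq V]
    {K L : PreAbstractSimplicialComplex V} {r : V → V} (h : K.IsSimplicialRetraction L r) :
    ∃ ρ : C(K.realization, L.realization),
      (∀ x, (ρ x : V → ℝ) = affineExtension r x) ∧
      ∀ x : K.realization, (x : V → ℝ) ∈ L.realization → (ρ x : V → ℝ) = x := by
  refine ⟨⟨fun x => ⟨affineExtension r x, h.affineExtension_mem x.2⟩, ?_⟩, fun _ => rfl,
    fun x hx => h.affineExtension_eq_self hx⟩
  refine Continuous.subtype_mk ?_ _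
  unfold affineExtension
  fun_prop

/-! ### The realization of the octahedral sphere -/

theorem mem_realization_map_octahedralSphere {V : Type*} [Fintype V] [DecidableEq V] {k : ℕ}
    (e : Fin (k + 1) × Fin 2 ↪ V) (x : V → ℝ) :
    x ∈ ((octahedralSphere k).map e).realization ↔
      (∀ v, 0 ≤ x v) ∧ ∑ v, x v = 1 ∧ (∀ v, v ∉ Set.range e → x v = 0) ∧
        ∀ i, x (e (i, 0)) = 0 ∨ x (e (i, 1)) = 0 := by
  refine and_congr_right fun hx0 => and_congr_right fun hx1 => ?_
  constructor
  · rintro ⟨_, ⟨t, ht, rfl⟩, hsupp⟩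
    have hmem : ∀ v, x v ≠ 0 ↔ ∃ a ∈ t, e a = v := fun v => by
      rw [← Set.mem_ofPred_eq (p := fun v => x v ≠ 0), hsupp]; simp
    constructor
    · intro v hv
      by_contra h0
      obtain ⟨a, -, rfl⟩ := (hmem v).1 h0
      exact hv ⟨a, rfl⟩
    · intro i
      by_contra! h0
      obtain ⟨a, ha, hae⟩ := (hmem _).1 h0.1
      obtain ⟨b, hb, hbe⟩ := (hmem _).1 h0.2
      rw [e.injective hae] at ha
      rw [e.injective hbe] at hb
      exact ht.2 i ⟨ha, hb⟩
  · rintro ⟨hr, hp⟩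
    classical
    refine ⟨_, ⟨Finset.univ.filter fun a => x (e a) ≠ 0, ⟨?_, ?_⟩, rfl⟩, ?_⟩
    · by_contra hne
      rw [Finset.not_nonempty_iff_eq_empty, Finset.filter_eq_empty_iff] at hne
      refine one_ne_zero (hx1.symm.trans (Finset.sum_eq_zero fun v _ => ?_))
      by_cases hv : v ∈ Set.range e
      · obtain ⟨a, rfl⟩ := hv
        simpa using hne (Finset.mem_univ a)
      · exact hr v hv
    · rintro i ⟨h0, h1⟩
      simp only [Finset.mem_filter, Finset.mem_univ, true_and] at h0 h1
      exact (hp i).elim h0 h1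
    · ext v
      simp only [Set.mem_ofPred_eq, Finset.coe_image, Finset.coe_filter, Finset.mem_univ, true_and,
        Set.mem_image]
      constructor
      · intro hv
        by_cases hv' : v ∈ Set.range e
        · obtain ⟨a, rfl⟩ := hv'
          exact ⟨a, hv, rfl⟩
        · exact absurd (hr v hv') hv
      · rintro ⟨a, ha, rfl⟩
        exact ha

theorem sum_eq_sum_pairs {V : Type*} [Fintype V] {k : ℕ} (e : Fin (k + 1) × Fin 2 ↪ V)
    {x : V → ℝ} (hx : ∀ v, v ∉ Set.range e → x v = 0) :
    ∑ v, x v = ∑ i, (x (e (i, 0)) + x (e (i, 1))) := by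
  classical
  rw [← Finset.sum_subset (Finset.subset_univ (Finset.univ.map e))
    (fun v _ hv => hx v (by simpa using hv)), Finset.sum_map, Fintype.sum_prod_type]
  simp

/-- The signed coordinates `xᵢ = x(i, 0) - x(i, 1)` identify the realization of the octahedral
`k`-sphere with the unit sphere of the `ℓ¹` norm on `ℝ^(k+1)`. -/
noncomputable def realizationHomeomorphL1Sphere {V : Type*} [Fintype V] [DecidableEq V] {k : ℕ}
    (e : Fin (k + 1) × Fin 2 ↪ V) :
    ((octahedralSphere k).map e).realization ≃ₜ {y : Fin (k + 1) → ℝ | ∑ i, |y i| = 1} where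
  toFun x := ⟨fun i => x.1 (e (i, 0)) - x.1 (e (i, 1)), by
    obtain ⟨h0, h1, hr, hp⟩ := (mem_realization_map_octahedralSphere e x.1).1 x.2
    rw [sum_eq_sum_pairs e hr] at h1
    refine (Finset.sum_congr rfl fun i _ => ?_).trans h1
    rcases hp i with h | h <;> simp [h, abs_of_nonneg (h0 _)]⟩
  invFun y := ⟨Function.extend e (fun a => if a.2 = 0 then max (y.1 a.1) 0 else max (-y.1 a.1) 0) 0,
    by
    have hr : ∀ v, v ∉ Set.range e → Function.extend e
        (fun a => if a.2 = 0 then max (y.1 a.1) 0 else max (-y.1 a.1) 0) 0 v = (0 : ℝ) :=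
      fun v hv => Function.extend_apply' _ _ _ hv
    refine (mem_realization_map_octahedralSphere e _).2 ⟨fun v => ?_, ?_, hr, fun i => ?_⟩
    · by_cases hv : v ∈ Set.range e
      · obtain ⟨a, rfl⟩ := hv
        rw [e.injective.extend_apply]
        split_ifs <;> exact le_max_right _ _
      · rw [hr v hv]
    · rw [sum_eq_sum_pairs e hr]
      refine (Finset.sum_congr rfl fun i _ => ?_).trans y.2
      rw [e.injective.extend_apply, e.injective.extend_apply]
      rcases le_total 0 (y.1 i) with h | h
      · simp [h, abs_of_nonneg h]
      · simp [h, abs_of_nonpos h]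
    · rw [e.injective.extend_apply, e.injective.extend_apply]
      rcases le_total 0 (y.1 i) with h | h <;> simp [h]⟩
  left_inv x := by
    obtain ⟨h0, h1, hr, hp⟩ := (mem_realization_map_octahedralSphere e x.1).1 x.2
    refine Subtype.ext (funext fun v => ?_)
    by_cases hv : v ∈ Set.range e
    · obtain ⟨⟨i, b⟩, rfl⟩ := hv
      dsimp only
      rw [e.injective.extend_apply]
      fin_cases b <;> rcases hp i with h | h <;> simp [h, h0]
    · rw [hr v hv]
      dsimp only
      rw [Function.extend_apply' _ _ _ hv, Pi.zero_apply]
  right_inv y := by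
    refine Subtype.ext (funext fun i => ?_)
    dsimp only
    rw [e.injective.extend_apply, e.injective.extend_apply]
    rcases le_total 0 (y.1 i) with h | h <;> simp [h]
  continuous_toFun := by
    have hc : ∀ v, Continuous fun x : ((octahedralSphere k).map e).realization => x.1 v :=
      fun v => (continuous_apply v).comp continuous_subtype_val
    exact Continuous.subtype_mk (continuous_pi fun i => (hc _).sub (hc _)) _
  continuous_invFun := by
    have hc : ∀ i, Continuous fun y : {y : Fin (k + 1) → ℝ | ∑ i, |y i| = 1} => y.1 i :=
      fun i => (continuous_apply i).comp continuous_subtype_val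
    refine Continuous.subtype_mk (continuous_pi fun v => ?_) _
    by_cases hv : v ∈ Set.range e
    · obtain ⟨a, rfl⟩ := hv
      simp only [e.injective.extend_apply]
      split_ifs
      · exact (hc _).max continuous_const
      · exact (hc _).neg.max continuous_const
    · simp only [Function.extend_apply' _ _ _ hv]
      exact continuous_const

/-- Radial projection from the unit sphere of the `ℓ¹` norm to the Euclidean unit sphere. -/
noncomputable def l1SphereHomeomorphSphere (ι : Type*) [Fintype ι] :
    {y : ι → ℝ | ∑ i, |y i| = 1} ≃ₜ Metric.sphere (0 : EuclideanSpace ℝ ι) 1 := by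
  have hpos : ∀ z : Metric.sphere (0 : EuclideanSpace ℝ ι) 1, 0 < ∑ i, |z.1 i| := fun z => by
    refine (Finset.sum_nonneg fun i _ => abs_nonneg _).lt_of_ne fun h => ?_
    have h0 : z.1 = 0 := by
      ext i
      have := (Finset.sum_eq_zero_iff_of_nonneg fun i _ => abs_nonneg (z.1 i)).1 h.symm i
      simpa using this
    have h1 := z.2
    rw [mem_sphere_zero_iff_norm, h0, norm_zero] at h1
    exact zero_ne_one h1
  have hne : ∀ y : {y : ι → ℝ | ∑ i, |y i| = 1}, 0 < ‖WithLp.toLp 2 y.1‖ := fun y => by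
    refine norm_pos_iff.2 fun h => ?_
    have h0 : y.1 = 0 := by
      funext i
      exact congrArg (fun z : EuclideanSpace ℝ ι => z i) h
    have h1 : ∑ i, |y.1 i| = 1 := y.2
    simp [h0] at h1
  exact
  { toFun := fun y => ⟨‖WithLp.toLp 2 y.1‖⁻¹ • WithLp.toLp 2 y.1, by
      rw [mem_sphere_zero_iff_norm, norm_smul, norm_inv, norm_norm,
        inv_mul_cancel₀ (hne y).ne']⟩
    invFun := fun z => ⟨fun i => (∑ j, |z.1 j|)⁻¹ * z.1 i, by
      simp only [Set.mem_ofPred_eq, abs_mul, abs_inv, abs_of_pos (hpos z), ← Finset.mul_sum]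
      exact inv_mul_cancel₀ (hpos z).ne'⟩
    left_inv := fun y => by
      have h1 : ∑ i, |y.1 i| = 1 := y.2
      have := hne y
      refine Subtype.ext (funext fun i => ?_)
      simp only [PiLp.smul_apply, smul_eq_mul, abs_mul, abs_inv, abs_norm, ← Finset.mul_sum, h1]
      field_simp
    right_inv := fun z => by
      have h1 : ‖z.1‖ = 1 := mem_sphere_zero_iff_norm.1 z.2
      have h2 : WithLp.toLp 2 (fun i => (∑ j, |z.1 j|)⁻¹ * z.1 i) = (∑ j, |z.1 j|)⁻¹ • z.1 := by
        ext i; simp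
      refine Subtype.ext ?_
      simp only [h2]
      rw [norm_smul, h1, norm_inv, Real.norm_eq_abs, abs_of_pos (hpos z), smul_smul, mul_one,
        inv_inv, mul_inv_cancel₀ (hpos z).ne', one_smul]
    continuous_toFun := by
      refine Continuous.subtype_mk ?_ _
      have hc : Continuous fun y : {y : ι → ℝ | ∑ i, |y i| = 1} => WithLp.toLp 2 y.1 :=
        (PiLp.continuous_toLp 2 _).comp continuous_subtype_val
      exact (hc.norm.inv₀ fun y => (hne y).ne').smul hc
    continuous_invFun := by
      refine Continuous.subtype_mk (continuous_pi fun i => ?_) _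
      have hc : ∀ i, Continuous fun z : Metric.sphere (0 : EuclideanSpace ℝ ι) 1 => z.1 i :=
        fun i => by fun_prop
      exact ((continuous_finsetSum _ fun j _ => (hc j).abs).inv₀ fun z => (hpos z).ne').mul
        (hc i) }

/-! ### Octahedral spheres without cones in a clique complex -/

/-- The vertices `e a` span an induced octahedral sphere in the clique complex of `G`, and no
vertex outside of it is adjacent to all the vertices of a facet: every outside vertex has
no neighbour in one of the antipodal pairs. -/
structure IsConeFreeOctahedron {V : Type*} (G : SimpleGraph V) {k : ℕ}
    (e : Fin (k + 1) × Fin 2 ↪ V) : Prop where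
  adj_iff : ∀ a b, G.Adj (e a) (e b) ↔ a.1 ≠ b.1
  exists_pair : ∀ x, x ∉ Set.range e → ∃ i, ∀ b, ¬ G.Adj x (e (i, b))

theorem IsConeFreeOctahedron.isInducedOctahedralSphere {V : Type*} [DecidableEq V]
    {G : SimpleGraph V} {k : ℕ} {e : Fin (k + 1) × Fin 2 ↪ V} (h : IsConeFreeOctahedron G e) :
    G.cliqueComplex.IsInducedOctahedralSphere ((octahedralSphere k).map e) k := by
  refine ⟨e, rfl, PreAbstractSimplicialComplex.ext (Set.ext fun s => ?_)⟩
  constructor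
  · rintro ⟨t, ht, rfl⟩
    refine ⟨⟨ht.1.image _, ?_⟩, by simp⟩
    rw [Finset.coe_image]
    rintro _ ⟨⟨i, a⟩, ha, rfl⟩ _ ⟨⟨j, b⟩, hb, rfl⟩ hne
    rw [h.adj_iff]
    rintro (rfl : i = j)
    have := ht.2 i
    rw [Finset.mem_coe] at ha hb
    fin_cases a <;> fin_cases b <;> simp_all
  · rintro ⟨⟨hne, hc⟩, hs⟩
    obtain ⟨t, rfl⟩ : ∃ t : Finset (Fin (k + 1) × Fin 2), t.image e = s := by
      rw [← Set.image_univ] at hs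
      obtain ⟨t, -, ht⟩ := Finset.subset_set_image_iff.1 hs
      exact ⟨t, ht⟩
    refine ⟨t, ⟨Finset.image_nonempty.1 hne, fun i hi => ?_⟩, rfl⟩
    have := hc (Finset.mem_coe.2 (Finset.mem_image_of_mem e hi.1))
      (Finset.mem_coe.2 (Finset.mem_image_of_mem e hi.2)) (e.injective.ne (by simp))
    rw [h.adj_iff] at this
    exact this rfl

/-- An outside vertex is retracted to the vertex `(i, 0)` of a pair `i` in which it has no
neighbour. Images of outside vertices are then never antipodal to one another, nor to an adjacent
vertex of the sphere. -/
theorem IsConeFreeOctahedron.exists_isSimplicialRetraction {V : Type*} [DecidableEq V]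
    {G : SimpleGraph V} {k : ℕ} {e : Fin (k + 1) × Fin 2 ↪ V} (h : IsConeFreeOctahedron G e) :
    ∃ r, G.cliqueComplex.IsSimplicialRetraction ((octahedralSphere k).map e) r := by
  classical
  choose! i hi using h.exists_pair
  refine ⟨fun x => if x ∈ Set.range e then x else e (i x, 0), ?_, ?_, ?_⟩
  · obtain ⟨e', he', h'⟩ := h.isInducedOctahedralSphere
    rw [h']
    exact fun s hs => hs.1
  · rintro s ⟨hne, hc⟩
    obtain ⟨t, ht⟩ : ∃ t : Finset (Fin (k + 1) × Fin 2),
        t.image e = s.image fun x => if x ∈ Set.range e then x else e (i x, 0) := by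
      have : ((s.image fun x => if x ∈ Set.range e then x else e (i x, 0) : Finset V) : Set V) ⊆
          e '' Set.univ := by
        rw [Set.image_univ]
        intro y hy
        obtain ⟨x, -, rfl⟩ := Finset.mem_image.1 (Finset.mem_coe.1 hy)
        split_ifs with hx
        · exact hx
        · exact ⟨_, rfl⟩
      obtain ⟨t, -, ht⟩ := Finset.subset_set_image_iff.1 this
      exact ⟨t, ht⟩
    refine ⟨t, ⟨?_, ?_⟩, ht⟩
    · rw [← Finset.image_nonempty (f := e), ht]
      exact hne.image _
    · rintro j ⟨h0, h1⟩
      have h0 := Finset.mem_image_of_mem e h0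
      have h1 := Finset.mem_image_of_mem e h1
      rw [ht, Finset.mem_image] at h0 h1
      obtain ⟨x, hx, hxe⟩ := h0
      obtain ⟨y, hy, hye⟩ := h1
      -- an outside vertex is never mapped to `(j, 1)`
      have hy' : y = e (j, 1) := by
        split_ifs at hye with hyr
        · exact hye
        · simpa using e.injective hye
      subst hy'
      have hxy : x = e (j, 1) ∨ G.Adj x (e (j, 1)) := by
        by_cases hxe : x = e (j, 1)
        · exact Or.inl hxe
        · exact Or.inr (hc hx hy hxe)
      split_ifs at hxe with hxr
      · subst hxe
        rcases hxy with h2 | h2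
        · simpa using e.injective h2
        · exact (h.adj_iff _ _).1 h2 rfl
      · have hij : i x = j := by simpa using e.injective hxe
        rcases hxy with h2 | h2
        · exact hxr ⟨_, h2.symm⟩
        · exact hi x hxr 1 (hij ▸ h2)
  · rintro v ⟨t, -, ht⟩
    have hv : v ∈ t.image e := by
      have ht : t.image e = {v} := ht
      simp [ht]
    obtain ⟨a, -, rfl⟩ := Finset.mem_image.1 hv
    simp

theorem IsConeFreeOctahedron.retractsOntoOctahedralSphere {V : Type*} [Fintype V] [DecidableEq V]
    {G : SimpleGraph V} {k : ℕ} {e : Fin (k + 1) × Fin 2 ↪ V} (h : IsConeFreeOctahedron G e) :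
    G.cliqueComplex.RetractsOntoOctahedralSphere k := by
  obtain ⟨r, hr⟩ := h.exists_isSimplicialRetraction
  exact ⟨_, r, h.isInducedOctahedralSphere, hr,
    ⟨(realizationHomeomorphL1Sphere e).trans (l1SphereHomeomorphSphere _)⟩,
    hr.exists_continuousMap⟩

end PreAbstractSimplicialComplex

/-! ### Determinants as simplicial chains and cochains -/

section OrientedDet

variable {V : Type*} [LinearOrder V] {m : ℕ}

theorem Finset.card_filter_lt_orderEmbOfFin (s : Finset V) (h : s.card = m) (i : Fin m) :
    (s.filter (· < s.orderEmbOfFin h i)).card = i := by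
  have : s.filter (· < s.orderEmbOfFin h i) =
      (Finset.Iio i).map (s.orderEmbOfFin h).toEmbedding := by
    ext v
    simp only [Finset.mem_filter, Finset.mem_map, Finset.mem_Iio, RelEmbedding.coe_toEmbedding]
    constructor
    · rintro ⟨hv, hlt⟩
      obtain ⟨j, rfl⟩ : v ∈ Set.range (s.orderEmbOfFin h) := by
        rw [Finset.range_orderEmbOfFin]; exact hv
      exact ⟨j, (s.orderEmbOfFin h).lt_iff_lt.1 hlt, rfl⟩
    · rintro ⟨j, hj, rfl⟩
      exact ⟨Finset.orderEmbOfFin_mem _ _ _, (s.orderEmbOfFin h).lt_iff_lt.2 hj⟩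
  rw [this, Finset.card_map, Fin.card_Iio]

theorem Finset.orderEmbOfFin_erase (s : Finset V) (h : s.card = m + 1) (i : Fin (m + 1))
    (h' : (s.erase (s.orderEmbOfFin h i)).card = m) (j : Fin m) :
    (s.erase (s.orderEmbOfFin h i)).orderEmbOfFin h' j = s.orderEmbOfFin h (i.succAbove j) := by
  have := Finset.orderEmbOfFin_unique h' (f := fun j => s.orderEmbOfFin h (i.succAbove j))
    (fun j => Finset.mem_erase.2 ⟨fun hj => i.succAbove_ne j ((s.orderEmbOfFin h).injective hj),
      Finset.orderEmbOfFin_mem _ _ _⟩)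
    ((s.orderEmbOfFin h).strictMono.comp (Fin.strictMono_succAbove i))
  exact (congrFun this j).symm

/-- The determinant of the vectors `w v`, for the vertices `v` of `s` in increasing order; it is
`0` unless `s` has exactly `m` vertices. -/
def orientedDet (w : V → Fin m → ℤ) (s : Finset V) : ℤ :=
  if h : s.card = m then (Matrix.of fun i => w (s.orderEmbOfFin h i)).det else 0

theorem orientedDet_of_card (w : V → Fin m → ℤ) {s : Finset V} (h : s.card = m) :
    orientedDet w s = (Matrix.of fun i => w (s.orderEmbOfFin h i)).det := dif_pos h

theorem orientedDet_eq_zero_of_row {w : V → Fin m → ℤ} {s : Finset V} {v : V} (hv : v ∈ s)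
    (hw : w v = 0) : orientedDet w s = 0 := by
  by_cases h : s.card = m
  · obtain ⟨i, rfl⟩ : v ∈ Set.range (s.orderEmbOfFin h) := by
      rw [Finset.range_orderEmbOfFin]; exact hv
    rw [orientedDet_of_card w h]
    exact Matrix.det_eq_zero_of_row_eq_zero i fun j => congrFun hw j
  · exact dif_neg h

theorem orientedDet_eq_zero_of_add_eq_zero {w : V → Fin m → ℤ} {s : Finset V} {u v : V}
    (hu : u ∈ s) (hv : v ∈ s) (huv : u ≠ v) (hw : w u + w v = 0) : orientedDet w s = 0 := by
  by_cases h : s.card = m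
  · obtain ⟨i, rfl⟩ : u ∈ Set.range (s.orderEmbOfFin h) := by
      rw [Finset.range_orderEmbOfFin]; exact hu
    obtain ⟨j, rfl⟩ : v ∈ Set.range (s.orderEmbOfFin h) := by
      rw [Finset.range_orderEmbOfFin]; exact hv
    rw [orientedDet_of_card w h, ← Matrix.det_updateRow_add_self _ (i := i) (j := j)
      fun hij => huv (by rw [hij])]
    refine Matrix.det_eq_zero_of_row_eq_zero i fun l => ?_
    rw [Matrix.updateRow_self]
    exact congrFun hw l
  · exact dif_neg h

/-- The coboundary of the cochain `orientedDet w` is a determinant with an additional column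
of ones, by Laplace expansion. -/
theorem sum_orientedDet_erase (w : V → Fin m → ℤ) {s : Finset V} (h : s.card = m + 1) :
    ∑ v ∈ s, (-1 : ℤ) ^ (s.filter (· < v)).card * orientedDet w (s.erase v) =
      (Matrix.of (fun i => Fin.cons 1 (w (s.orderEmbOfFin h i)) :
        Fin (m + 1) → Fin (m + 1) → ℤ)).det := by
  have hsum : ∀ F : V → ℤ, ∑ v ∈ s, F v = ∑ i, F (s.orderEmbOfFin h i) := fun F => by
    conv_lhs => rw [← Finset.map_orderEmbOfFin_univ s h, Finset.sum_map]
    rfl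
  rw [Matrix.det_succ_column_zero, hsum]
  refine Finset.sum_congr rfl fun i _ => ?_
  have h' : (s.erase (s.orderEmbOfFin h i)).card = m := by
    rw [Finset.card_erase_of_mem (Finset.orderEmbOfFin_mem _ _ _), h]; rfl
  have hsub : (Matrix.of (fun i => Fin.cons 1 (w (s.orderEmbOfFin h i)) :
        Fin (m + 1) → Fin (m + 1) → ℤ)).submatrix i.succAbove Fin.succ =
      Matrix.of fun j => w ((s.erase (s.orderEmbOfFin h i)).orderEmbOfFin h' j) := by
    ext a b
    simp [Finset.orderEmbOfFin_erase]
  rw [hsub, ← orientedDet_of_card w h', Finset.card_filter_lt_orderEmbOfFin,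
    Matrix.of_apply, Fin.cons_zero, mul_one]

theorem sum_orientedDet_erase_eq_zero (w : V → Fin m → ℤ) {s : Finset V} (h : s.card = m + 1)
    {u v : V} (hu : u ∈ s) (hv : v ∈ s) (huv : u ≠ v) (hw : w u = w v) :
    ∑ v ∈ s, (-1 : ℤ) ^ (s.filter (· < v)).card * orientedDet w (s.erase v) = 0 := by
  rw [sum_orientedDet_erase w h]
  obtain ⟨i, rfl⟩ : u ∈ Set.range (s.orderEmbOfFin h) := by
    rw [Finset.range_orderEmbOfFin]; exact hu
  obtain ⟨j, rfl⟩ : v ∈ Set.range (s.orderEmbOfFin h) := by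
    rw [Finset.range_orderEmbOfFin]; exact hv
  refine Matrix.det_zero_of_row_eq (i := i) (j := j) (fun hij => huv (by rw [hij])) ?_
  funext l
  rw [Matrix.of_apply, Matrix.of_apply, hw]

/-- Up to the sign in the boundary map, `orientedDet w` of the coface `insert v t` is the
determinant in which the row of the new vertex comes first. -/
theorem orientedDet_insert (w : V → Fin (m + 1) → ℤ) {t : Finset V} (h : t.card = m) {v : V}
    (hv : v ∉ t) :
    (-1 : ℤ) ^ ((insert v t).filter (· < v)).card * orientedDet w (insert v t) =
      (Matrix.of (Fin.cons (w v) fun i => w (t.orderEmbOfFin h i) :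
        Fin (m + 1) → Fin (m + 1) → ℤ)).det := by
  obtain ⟨s, hs⟩ : ∃ s, s = insert v t := ⟨_, rfl⟩
  have hcard : s.card = m + 1 := by rw [hs, Finset.card_insert_of_notMem hv, h]
  have hvs : v ∈ s := hs ▸ Finset.mem_insert_self _ _
  have ht : t = s.erase v := by rw [hs, Finset.erase_insert hv]
  rw [← hs]
  clear hs
  subst ht
  obtain ⟨i, rfl⟩ : v ∈ Set.range (s.orderEmbOfFin hcard) := by
    rw [Finset.range_orderEmbOfFin]; exact hvs
  rw [orientedDet_of_card w hcard, Finset.card_filter_lt_orderEmbOfFin, Matrix.det_succ_row _ i,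
    Matrix.det_succ_row_zero, Finset.mul_sum]
  refine Finset.sum_congr rfl fun j _ => ?_
  have hsub : (Matrix.of fun i => w (s.orderEmbOfFin hcard i)).submatrix i.succAbove j.succAbove =
      (Matrix.of (Fin.cons (w (s.orderEmbOfFin hcard i)) fun i' =>
        w ((s.erase (s.orderEmbOfFin hcard i)).orderEmbOfFin h i') :
        Fin (m + 1) → Fin (m + 1) → ℤ)).submatrix Fin.succ j.succAbove := by
    ext a b
    simp [Finset.orderEmbOfFin_erase]
  rw [hsub]
  simp only [Matrix.of_apply, Fin.cons_zero]
  have hsq : ((-1 : ℤ) ^ (i : ℕ)) * (-1) ^ (i : ℕ) = 1 := by rw [← mul_pow]; simp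
  have hsign : ∀ c D : ℤ, (-1) ^ (i : ℕ) * ((-1) ^ (i + j : ℕ) * c * D) = (-1) ^ (j : ℕ) * c * D :=
    fun c D => by
      rw [pow_add]
      linear_combination (-1 : ℤ) ^ (j : ℕ) * c * D * hsq
  exact hsign _ _

end OrientedDet

theorem hasIntSummand_of_apply_eq_one {H : Type*} [AddCommGroup H] (ψ : H →+ ℤ) {x : H}
    (hx : ψ x = 1) : HasIntSummand H := by
  have hz : ∀ n : ℤ, ψ (n • x) = n := fun n => by rw [map_zsmul, hx]; simp
  refine ⟨AddSubgroup.zmultiples x, ψ.ker, ⟨?_, ?_⟩, ⟨AddEquiv.symm ?_⟩⟩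
  · rw [AddSubgroup.disjoint_def]
    rintro y ⟨n, rfl⟩ hy
    have h0 : n = 0 := (hz n).symm.trans hy
    simp [h0]
  · rw [codisjoint_iff, eq_top_iff]
    intro y _
    refine AddSubgroup.mem_sup.2 ⟨ψ y • x, ⟨_, rfl⟩, y - ψ y • x, ?_, by abel⟩
    rw [AddMonoidHom.mem_ker, map_sub, hz, sub_self]
  · refine AddEquiv.ofBijective ((zmultiplesHom H x).codRestrict
      (AddSubgroup.zmultiples x) fun n => ⟨n, rfl⟩) ⟨?_, ?_⟩
    · intro a b hab
      have h1 : a • x = b • x := congrArg Subtype.val hab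
      rw [← hz a, ← hz b, h1]
    · rintro ⟨_, n, rfl⟩
      exact ⟨n, rfl⟩

namespace PreAbstractSimplicialComplex

/-! ### The class of a retract sphere in reduced homology -/

theorem card_le_of_mem_map_octahedralSphere {V : Type*} [DecidableEq V] {k : ℕ}
    {e : Fin (k + 1) × Fin 2 ↪ V} {s : Finset V} (hs : s ∈ ((octahedralSphere k).map e).faces) :
    s.card ≤ k + 1 := by
  obtain ⟨t, ht, rfl⟩ := hs
  refine Finset.card_image_le.trans ?_
  refine (Finset.card_le_card_of_injOn (t := Finset.univ) Prod.fst
    (fun _ _ => Finset.mem_coe.2 (Finset.mem_univ _)) ?_).trans_eq (Finset.card_fin _)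
  rintro ⟨i, a⟩ ha ⟨j, b⟩ hb (rfl : i = j)
  have := ht.2 i
  rw [Finset.mem_coe] at ha hb
  fin_cases a <;> fin_cases b <;> simp_all

/-- The vector `±` the `j`-th basis vector at the vertex `(j, 0)`, resp. `(j, 1)`, of the
octahedral sphere, and `0` at all other vertices: the embedding of the octahedral sphere as the
boundary of the cross-polytope. -/
def crossPolytopeVector {V : Type*} [DecidableEq V] {k : ℕ} (e : Fin (k + 1) × Fin 2 ↪ V) (v : V)
    (j : Fin (k + 1)) : ℤ :=
  (if v = e (j, 0) then 1 else 0) - if v = e (j, 1) then 1 else 0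

theorem sum_crossPolytopeVector {V : Type*} [Fintype V] [DecidableEq V] {k : ℕ}
    (e : Fin (k + 1) × Fin 2 ↪ V) (j : Fin (k + 1)) : ∑ v, crossPolytopeVector e v j = 0 := by
  simp [crossPolytopeVector]

theorem mem_of_orientedDet_crossPolytopeVector_ne_zero {V : Type*} [LinearOrder V] {k : ℕ}
    (e : Fin (k + 1) × Fin 2 ↪ V) {s : Finset V}
    (h : orientedDet (crossPolytopeVector e) s ≠ 0) :
    s ∈ ((octahedralSphere k).map e).faces := by
  have hcard : s.card = k + 1 := by
    by_contra hc
    exact h (dif_neg hc)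
  obtain ⟨t, rfl⟩ : ∃ t : Finset (Fin (k + 1) × Fin 2), t.image e = s := by
    have : (s : Set V) ⊆ e '' Set.univ := by
      rw [Set.image_univ]
      intro v hv
      by_contra hr
      refine h (orientedDet_eq_zero_of_row (Finset.mem_coe.1 hv) (funext fun j => ?_))
      have h0 : v ≠ e (j, 0) := fun h0 => hr ⟨_, h0.symm⟩
      have h1 : v ≠ e (j, 1) := fun h1 => hr ⟨_, h1.symm⟩
      simp [crossPolytopeVector, h0, h1]
    obtain ⟨t, -, ht⟩ := Finset.subset_set_image_iff.1 this
    exact ⟨t, ht⟩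
  refine ⟨t, ⟨?_, fun i hi => h ?_⟩, rfl⟩
  · rw [← Finset.image_nonempty (f := e), ← Finset.card_pos, hcard]
    exact k.succ_pos
  · refine orientedDet_eq_zero_of_add_eq_zero (Finset.mem_image_of_mem e hi.1)
      (Finset.mem_image_of_mem e hi.2) (e.injective.ne (by simp)) (funext fun j => ?_)
    simp [crossPolytopeVector, e.injective.eq_iff]

theorem linearCombination_boundary {V : Type*} [LinearOrder V] (K : PreAbstractSimplicialComplex V)
    {m : ℕ} (f : K.AugFace m → ℤ) (s : K.AugFace (m + 1)) (a : ℤ) :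
    Finsupp.linearCombination ℤ f (K.boundary m (Finsupp.single s a)) =
      a * ∑ v : {v // v ∈ s.1}, (-1 : ℤ) ^ (s.1.filter (· < v.1)).card * f (s.erase v) := by
  simp [boundary, Finsupp.linearCombination_single]

/-- The fundamental cycle of the octahedral sphere: the facets with the orientations that they
have on the boundary of the cross-polytope. -/
noncomputable def octahedralCycle {V : Type*} [LinearOrder V] [Fintype V]
    (K : PreAbstractSimplicialComplex V) {k : ℕ} (e : Fin (k + 1) × Fin 2 ↪ V) :
    K.AugChain (k + 1) :=
  haveI : Finite (K.AugFace (k + 1)) := Subtype.finite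
  Finsupp.equivFunOnFinite.symm fun s => orientedDet (crossPolytopeVector e) s.1

theorem linearCombination_octahedralCycle {V : Type*} [LinearOrder V] [Fintype V]
    (K : PreAbstractSimplicialComplex V) {k : ℕ} (e : Fin (k + 1) × Fin 2 ↪ V)
    [Fintype (K.AugFace (k + 1))] {M : Type*} [AddCommGroup M] (f : K.AugFace (k + 1) → M) :
    Finsupp.linearCombination ℤ f (K.octahedralCycle e) =
      ∑ s : K.AugFace (k + 1), orientedDet (crossPolytopeVector e) s.1 • f s := by
  rw [Finsupp.linearCombination_apply, Finsupp.sum_fintype _ _ (by simp)]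
  rfl

/-- The coefficient of the boundary at a face `t` is the sum over all vertices `v` of the
determinants with rows `v, t₀, t₁, …`; it vanishes since the vectors of all vertices sum to `0`. -/
theorem boundary_octahedralCycle {V : Type*} [LinearOrder V] [Fintype V]
    {K : PreAbstractSimplicialComplex V} {k : ℕ} {e : Fin (k + 1) × Fin 2 ↪ V}
    (hL : (octahedralSphere k).map e ≤ K) : K.boundary k (K.octahedralCycle e) = 0 := by
  classical
  have : Finite (K.AugFace (k + 1)) := Subtype.finite
  have := Fintype.ofFinite (K.AugFace (k + 1))
  set w := crossPolytopeVector e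
  refine Finsupp.ext fun t => ?_
  let A : V → Matrix (Fin (k + 1)) (Fin (k + 1)) ℤ := fun v =>
    Matrix.of (Fin.cons (w v) fun i => w (t.1.orderEmbOfFin t.2.1 i))
  have hA : ∑ v, (A v).det = 0 := by
    simp only [Matrix.det_succ_row_zero]
    rw [Finset.sum_comm]
    refine Finset.sum_eq_zero fun j _ => ?_
    have : ∀ v, (A v).submatrix Fin.succ j.succAbove =
        Matrix.of fun i l => w (t.1.orderEmbOfFin t.2.1 i) (j.succAbove l) := fun v => by
      ext a b; simp [A]
    simp only [this]
    rw [← Finset.sum_mul, ← Finset.mul_sum]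
    have h0 : ∑ v, A v 0 j = 0 := sum_crossPolytopeVector e j
    rw [h0]; simp
  rw [boundary, linearCombination_octahedralCycle, Finsupp.finsetSum_apply, Finsupp.zero_apply,
    ← hA]
  have hstep : ∀ s : K.AugFace (k + 1), (orientedDet w s.1 •
      ∑ v : {v // v ∈ s.1}, Finsupp.single (s.erase v)
        ((-1 : ℤ) ^ (s.1.filter (· < v.1)).card)) t =
      ∑ v : V, if v ∈ s.1 ∧ s.1.erase v = t.1 then
        (-1 : ℤ) ^ (s.1.filter (· < v)).card * orientedDet w s.1 else 0 := fun s => by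
    rw [Finsupp.smul_apply, Finsupp.finsetSum_apply, Finset.smul_sum]
    simp only [ite_and]
    rw [← Finset.sum_filter, Finset.sum_subtype (p := fun v => v ∈ s.1) _ (by simp)]
    refine Finset.sum_congr rfl fun v _ => ?_
    have : s.erase v = t ↔ s.1.erase v.1 = t.1 := Subtype.ext_iff
    simp only [Finsupp.single_apply, this, smul_eq_mul, mul_ite, mul_zero]
    rw [mul_comm]
  rw [Finset.sum_congr rfl fun s _ => hstep s, Finset.sum_comm]
  refine Finset.sum_congr rfl fun v _ => ?_
  by_cases hex : ∃ s : K.AugFace (k + 1), v ∈ s.1 ∧ s.1.erase v = t.1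
  · obtain ⟨s, hv, hs⟩ := hex
    have hvt : v ∉ t.1 := by rw [← hs]; simp
    have hins : s.1 = insert v t.1 := by rw [← hs, Finset.insert_erase hv]
    rw [Finset.sum_eq_single s, if_pos ⟨hv, hs⟩, hins, orientedDet_insert w t.2.1 hvt]
    · intro s' _ hne
      refine if_neg fun h => hne (Subtype.ext ?_)
      rw [hins, ← h.2, Finset.insert_erase h.1]
    · simp
  · rw [Finset.sum_eq_zero fun s _ => if_neg fun h => hex ⟨s, h⟩]
    by_cases hvt : v ∈ t.1
    · obtain ⟨i, hi⟩ : v ∈ Set.range (t.1.orderEmbOfFin t.2.1) := by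
        rw [Finset.range_orderEmbOfFin]; exact hvt
      refine (Matrix.det_zero_of_row_eq (i := 0) (j := i.succ) (Fin.succ_ne_zero i).symm ?_).symm
      simp only [A]
      funext j
      simp [Matrix.of_apply, hi]
    · rw [← orientedDet_insert w t.2.1 hvt]
      by_contra hne
      have h0 : orientedDet w (insert v t.1) ≠ 0 := fun h0 => hne (by rw [h0, mul_zero])
      exact hex ⟨⟨insert v t.1, by rw [Finset.card_insert_of_notMem hvt, t.2.1],
        Or.inr (hL (mem_of_orientedDet_crossPolytopeVector_ne_zero e h0))⟩,
        Finset.mem_insert_self _ _, Finset.erase_insert hvt⟩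

/-- The cocycle that pulls back, along the vertex map `r`, the cochain which is dual to the
facet `(0, 0), …, (k, 0)` of the octahedral sphere. -/
noncomputable def facetCochain {V : Type*} [LinearOrder V] (K : PreAbstractSimplicialComplex V)
    {k : ℕ} (e : Fin (k + 1) × Fin 2 ↪ V) (r : V → V) : K.AugChain (k + 1) →ₗ[ℤ] ℤ :=
  Finsupp.linearCombination ℤ fun s =>
    orientedDet (fun v j => if r v = e (j, 0) then 1 else 0) s.1

/-- A face with `k + 2` vertices is mapped into a face of the octahedral sphere, so `r` identifies
two of its vertices. -/
theorem IsSimplicialRetraction.facetCochain_boundary {V : Type*} [LinearOrder V]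
    {K : PreAbstractSimplicialComplex V} {k : ℕ} {e : Fin (k + 1) × Fin 2 ↪ V} {r : V → V}
    (h : K.IsSimplicialRetraction ((octahedralSphere k).map e) r) (c : K.AugChain (k + 2)) :
    K.facetCochain e r (K.boundary (k + 1) c) = 0 := by
  induction c using Finsupp.induction_linear with
  | zero => simp
  | add f g hf hg => simp [hf, hg]
  | single s a =>
    rw [facetCochain, linearCombination_boundary]
    have hs : s.1 ∈ K.faces := s.2.2.resolve_left fun h0 => by
      have := s.2.1
      simp [h0] at this
    have hlt : (s.1.image r).card < s.1.card := by
      rw [s.2.1]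
      exact Nat.lt_succ_of_le (card_le_of_mem_map_octahedralSphere (h.image_mem _ hs))
    obtain ⟨u, hu, v, hv, huv, hr⟩ := Finset.exists_ne_map_eq_of_card_lt_of_maps_to hlt
      fun x hx => Finset.mem_coe.2 (Finset.mem_image_of_mem r hx)
    have := sum_orientedDet_erase_eq_zero
      (fun v (j : Fin (k + 1)) => if r v = e (j, 0) then (1 : ℤ) else 0) s.2.1 hu hv huv
      (by simp only [hr])
    rw [← Finset.sum_coe_sort] at this
    exact mul_eq_zero_of_right _ this

theorem IsSimplicialRetraction.facetCochain_octahedralCycle {V : Type*} [LinearOrder V] [Fintype V]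
    {K : PreAbstractSimplicialComplex V} {k : ℕ} {e : Fin (k + 1) × Fin 2 ↪ V} {r : V → V}
    (h : K.IsSimplicialRetraction ((octahedralSphere k).map e) r) :
    K.facetCochain e r (K.octahedralCycle e) = 1 := by
  classical
  have : Finite (K.AugFace (k + 1)) := Subtype.finite
  have := Fintype.ofFinite (K.AugFace (k + 1))
  rw [facetCochain, linearCombination_octahedralCycle]
  have hfix : ∀ a, r (e a) = e a := fun a => by
    refine h.apply_eq _ ⟨{a}, ⟨by simp, fun i hi => ?_⟩, by simp⟩
    simp only [Finset.mem_singleton] at hi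
    simpa using hi.1.trans hi.2.symm
  let t : Finset (Fin (k + 1) × Fin 2) := Finset.univ.image fun j => (j, 0)
  have ht : t ∈ (octahedralSphere k).faces :=
    ⟨Finset.univ_nonempty.image _, fun i hi => by simpa [t] using hi.2⟩
  have htc : (t.image e).card = k + 1 := by
    rw [Finset.card_image_of_injective _ e.injective,
      Finset.card_image_of_injective _ fun a b hab => congrArg Prod.fst hab]
    simp
  rw [Finset.sum_eq_single ⟨t.image e, htc, Or.inr (h.le ⟨t, ht, rfl⟩)⟩]
  · simp only [smul_eq_mul]
    rw [orientedDet_of_card _ htc, orientedDet_of_card _ htc]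
    choose π hπ using fun i => (show ∃ j, e (j, 0) = (t.image e).orderEmbOfFin htc i by
      have := Finset.orderEmbOfFin_mem (t.image e) htc i
      simpa only [t, Finset.image_image, Finset.mem_image, Finset.mem_univ, true_and,
        Function.comp_apply] using this)
    have hπi : Function.Injective π := fun a b hab => by
      apply ((t.image e).orderEmbOfFin htc).injective
      rw [← hπ, ← hπ, hab]
    simp only [← hπ, hfix, e.injective.eq_iff]
    -- both matrices are the permutation matrix of `π`
    have h1 : (Matrix.of fun i => crossPolytopeVector e (e (π i, 0))) =
        Matrix.of fun i j => if π i = j then (1 : ℤ) else 0 := by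
      ext i j
      simp [crossPolytopeVector, e.injective.eq_iff]
    have h2 : (Matrix.of fun i j => if ((π i, 0) : Fin (k + 1) × Fin 2) = (j, 0) then (1 : ℤ)
        else 0) = Matrix.of fun i j => if π i = j then (1 : ℤ) else 0 := by
      ext i j
      simp
    rw [h1, h2]
    generalize hP : (Matrix.of fun i j => if π i = j then (1 : ℤ) else 0) = P
    have hPP : P * P.transpose = 1 := by
      subst hP
      ext i j
      simp [Matrix.mul_apply, Matrix.one_apply, hπi.eq_iff, eq_comm]
    calc P.det * P.det = P.det * P.transpose.det := by rw [Matrix.det_transpose]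
      _ = 1 := by rw [← Matrix.det_mul, hPP, Matrix.det_one]
  · intro s _ hs
    rw [smul_eq_mul, mul_eq_zero, or_iff_not_imp_left]
    intro h0
    obtain ⟨t', -, ht'⟩ := mem_of_orientedDet_crossPolytopeVector_ne_zero e h0
    obtain ⟨v, hvs, hvt⟩ : ∃ v ∈ s.1, v ∉ t.image e := by
      by_contra! hsub
      exact hs (Subtype.ext (Finset.eq_of_subset_of_card_le hsub (by rw [htc, s.2.1])))
    refine orientedDet_eq_zero_of_row hvs (funext fun j => if_neg fun hj => hvt ?_)
    obtain ⟨a, -, rfl⟩ : ∃ a ∈ t', e a = v := by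
      rw [← Finset.mem_image]
      have ht' : t'.image e = s.1 := ht'
      rwa [ht']
    rw [← hfix a, hj]
    exact Finset.mem_image_of_mem e (by simp [t])
  · exact fun hn => absurd (Finset.mem_univ _) hn

theorem RetractsOntoOctahedralSphere.hasIntSummand {V : Type*} [LinearOrder V] [Fintype V]
    {K : PreAbstractSimplicialComplex V} {k : ℕ} (h : K.RetractsOntoOctahedralSphere k) :
    HasIntSummand (K.ReducedHomology k) := by
  obtain ⟨_, r, ⟨e, rfl, -⟩, hr, -⟩ := h
  let ψ : K.ReducedHomology k →ₗ[ℤ] ℤ := Submodule.liftQ _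
    ((K.facetCochain e r).comp (LinearMap.ker (K.boundary k)).subtype) (by
      rintro ⟨_, _⟩ ⟨c, rfl⟩
      exact hr.facetCochain_boundary c)
  exact hasIntSummand_of_apply_eq_one ψ.toAddMonoidHom
    (x := Submodule.Quotient.mk ⟨K.octahedralCycle e, boundary_octahedralCycle hr.le⟩)
    hr.facetCochain_octahedralCycle

end PreAbstractSimplicialComplex

/-! ### The second moment method -/

/-- If the number of events `A i` that occur is concentrated around its mean `N`, and few of these
are spoilt by `B i`, then some `A i` occurs unspoilt with high probability. -/
theorem MeasureTheory.one_sub_le_measureReal_iUnion_diff {Ω ι : Type*} [MeasurableSpace Ω]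
    [Finite Ω] [MeasurableSingletonClass Ω] [Fintype ι] (μ : Measure Ω) [IsProbabilityMeasure μ]
    (A B : ι → Set Ω) {N δ η : ℝ} (hN : 0 < N) (hA : ∑ i, μ.real (A i) = N)
    (hAA : ∑ i, ∑ j, μ.real (A i ∩ A j) ≤ (1 + δ) * N ^ 2)
    (hAB : ∑ i, μ.real (A i ∩ B i) ≤ η * N) :
    1 - 4 * δ - 2 * η ≤ μ.real (⋃ i, A i \ B i) := by
  let ind : Set Ω → Ω → ℝ := fun S => S.indicator 1
  have hint : ∀ f : Ω → ℝ, Integrable f μ := fun f => Integrable.of_finite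
  have hind : ∀ S : Set Ω, ∫ ω, ind S ω ∂μ = μ.real S := fun S =>
    integral_indicator_one S.toFinite.measurableSet
  have hnn : ∀ S ω, 0 ≤ ind S ω := fun S ω => Set.indicator_nonneg (fun _ _ => zero_le_one) ω
  set U := ⋃ i, A i \ B i
  let X : Ω → ℝ := fun ω => ∑ i, ind (A i) ω
  let Y : Ω → ℝ := fun ω => ∑ i, ind (A i ∩ B i) ω
  -- outside `U` one has `X = Y`, and `4 (X - N) ^ 2 + 2 N X - N ^ 2` is positive definite
  have hpt : ∀ ω, N ^ 2 ≤ N ^ 2 * ind U ω + (4 * (∑ i, ∑ j, ind (A i ∩ A j) ω) -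
      8 * N * X ω + 4 * N ^ 2) + 2 * N * Y ω := fun ω => by
    have hXX : ∑ i, ∑ j, ind (A i ∩ A j) ω = X ω ^ 2 := by
      simp only [X, ind, sq, Finset.sum_mul_sum, Set.inter_indicator_one, Pi.mul_apply]
    have hY : 0 ≤ Y ω := Finset.sum_nonneg fun i _ => hnn _ _
    rw [hXX]
    by_cases hω : ω ∈ U
    · have : ind U ω = 1 := Set.indicator_of_mem hω _
      rw [this]
      nlinarith [sq_nonneg (X ω - N), mul_nonneg hN.le hY]
    · have h0 : ind U ω = 0 := Set.indicator_of_notMem hω _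
      have hXY : X ω = Y ω := by
        refine Finset.sum_congr rfl fun i _ => ?_
        have : ω ∈ A i → ω ∈ B i := fun h => by
          by_contra hB
          exact hω (Set.mem_iUnion.2 ⟨i, h, hB⟩)
        by_cases h : ω ∈ A i
        · simp [ind, h, this h]
        · simp [ind, h]
      rw [h0, ← hXY]
      nlinarith [sq_nonneg (4 * X ω - 3 * N), sq_nonneg N]
  have hmono := integral_mono (hint _) (hint _) hpt
  have hX : ∫ ω, X ω ∂μ = N := by
    rw [← hA, integral_finsetSum _ fun i _ => hint _]
    simp only [hind]
  have hY : ∫ ω, Y ω ∂μ = ∑ i, μ.real (A i ∩ B i) := by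
    rw [integral_finsetSum _ fun i _ => hint _]
    simp only [hind]
  have hXX : ∫ ω, ∑ i, ∑ j, ind (A i ∩ A j) ω ∂μ = ∑ i, ∑ j, μ.real (A i ∩ A j) := by
    rw [integral_finsetSum _ fun i _ => hint _]
    refine Finset.sum_congr rfl fun i _ => ?_
    rw [integral_finsetSum _ fun i _ => hint _]
    simp only [hind]
  rw [integral_add (hint _) (hint _), integral_add (hint _) (hint _),
    integral_add (hint _) (hint _), integral_sub (hint _) (hint _), integral_const_mul,
    integral_const_mul, integral_const_mul, integral_const_mul, integral_const_mul, hX, hY,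
    hXX, hind] at hmono
  simp only [integral_const, probReal_univ, one_smul] at hmono
  have : N ^ 2 * (1 - 4 * δ - 2 * η) ≤ N ^ 2 * μ.real U := by
    nlinarith [mul_le_mul_of_nonneg_left hAB hN.le]
  exact le_of_mul_le_mul_left this (by positivity)

namespace SimpleGraph

theorem measurableSingletonClass {V : Type*} [Finite V] :
    MeasurableSingletonClass (SimpleGraph V) := by
  refine ⟨fun G => ?_⟩
  have h : {G} = (edgeSet : SimpleGraph V → Set (Sym2 V)) ⁻¹' {G.edgeSet} := by
    ext H; simp
  rw [h]
  exact measurable_edgeSet (MeasurableSet.singleton _)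

theorem binomialRandom_real_subset_edgeSet {V : Type*} [Finite V] (p : unitInterval)
    {T : Finset (Sym2 V)} (hT : ∀ e ∈ T, ¬ e.IsDiag) :
    (binomialRandom V p).real {G | (T : Set (Sym2 V)) ⊆ G.edgeSet} = (p : ℝ) ^ T.card := by
  classical
  have := measurableSingletonClass (V := V)
  have hpre : (fun p : Sym2 V → Prop => {i | p i}) ⁻¹'
      (fromEdgeSet ⁻¹' {G : SimpleGraph V | (T : Set (Sym2 V)) ⊆ G.edgeSet}) =
      (T : Set (Sym2 V)).pi fun _ => {True} := by
    ext q
    simp only [Set.mem_preimage, Set.mem_ofPred_eq, edgeSet_fromEdgeSet, Set.subset_def,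
      Finset.mem_coe, Set.mem_sdiff, Set.mem_pi, Set.mem_singleton_iff, eq_iff_iff, iff_true]
    exact forall₂_congr fun e he => and_iff_left (hT e he)
  rw [measureReal_def, binomialRandom_eq_map, Measure.map_apply measurable_fromEdgeSet
    (Set.toFinite _).measurableSet, ProbabilityTheory.setBernoulli_apply', hpre,
    Measure.infinitePi_pi _ fun _ _ => MeasurableSet.singleton _,
    Finset.prod_congr rfl (g := fun _ =>
      ((unitInterval.toNNReal p : NNReal) : ENNReal))]
  · simp
  · intro e he
    have : e ∈ (Sym2.diagSet : Set (Sym2 V))ᶜ := hT e he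
    simp [this]

/-! ### Copies of the octahedral graph -/

/-- The `1`-skeleton of the octahedral `k`-sphere. -/
def octahedralGraph (k : ℕ) : SimpleGraph (Fin (k + 1) × Fin 2) where
  Adj a b := a.1 ≠ b.1
  symm := ⟨fun _ _ h => h.symm⟩
  loopless := ⟨fun _ h => h rfl⟩

instance (k : ℕ) : DecidableRel (octahedralGraph k).Adj :=
  fun a b => inferInstanceAs (Decidable (a.1 ≠ b.1))

/-- The `1`-skeleton of the octahedral sphere has average degree at most `2k` on any set of
vertices. -/
theorem card_edgeFinset_filter_octahedralGraph_le {k : ℕ} (J : Finset (Fin (k + 1) × Fin 2)) :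
    ((octahedralGraph k).edgeFinset.filter fun e => ∀ a ∈ e, a ∈ J).card ≤ k * J.card := by
  classical
  let H : SimpleGraph (Fin (k + 1) × Fin 2) :=
    { Adj := fun a b => a.1 ≠ b.1 ∧ a ∈ J ∧ b ∈ J
      symm := ⟨fun _ _ h => ⟨h.1.symm, h.2.2, h.2.1⟩⟩
      loopless := ⟨fun _ h => h.1 rfl⟩ }
  have hH : (octahedralGraph k).edgeFinset.filter (fun e => ∀ a ∈ e, a ∈ J) = H.edgeFinset := by
    ext e
    induction e with
    | h a b =>
      simp only [Finset.mem_filter, mem_edgeFinset, mem_edgeSet, Sym2.mem_iff, forall_eq_or_imp,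
        forall_eq]
      rfl
  have hdeg : ∀ a, H.degree a ≤ if a ∈ J then 2 * k else 0 := fun a => by
    split_ifs with ha
    · calc (H.neighborFinset a).card
          ≤ (({a.1}ᶜ : Finset (Fin (k + 1))) ×ˢ (Finset.univ : Finset (Fin 2))).card := by
            refine Finset.card_le_card fun b hb => ?_
            rw [mem_neighborFinset] at hb
            simpa using hb.1.symm
        _ = 2 * k := by simp [Finset.card_compl, mul_comm]
    · rw [Nat.le_zero, ← card_neighborFinset_eq_degree, Finset.card_eq_zero,
        Finset.eq_empty_iff_forall_notMem]
      intro b hb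
      rw [mem_neighborFinset] at hb
      exact ha hb.2.1
  have hsum := (H.sum_degrees_eq_twice_card_edges).symm.trans_le
    (Finset.sum_le_sum fun a _ => hdeg a)
  rw [← Finset.sum_filter, Finset.filter_univ_mem, Finset.sum_const, smul_eq_mul] at hsum
  rw [hH]
  linarith

variable {V : Type*} {k : ℕ}

/-- The edges of the copy of the octahedral graph with vertices `e a`. -/
def octahedralEdges [DecidableEq V] (e : Fin (k + 1) × Fin 2 ↪ V) : Finset (Sym2 V) :=
  (octahedralGraph k).edgeFinset.image (Sym2.map e)

theorem card_octahedralEdges [DecidableEq V] (e : Fin (k + 1) × Fin 2 ↪ V) :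
    (octahedralEdges e).card = (octahedralGraph k).edgeFinset.card :=
  Finset.card_image_of_injective _ (Sym2.map.injective e.injective)

theorem not_isDiag_of_mem_octahedralEdges [DecidableEq V] {e : Fin (k + 1) × Fin 2 ↪ V} {s : Sym2 V}
    (hs : s ∈ octahedralEdges e) : ¬ s.IsDiag := by
  obtain ⟨t, ht, rfl⟩ := Finset.mem_image.1 hs
  rw [Sym2.isDiag_map e.injective]
  exact (octahedralGraph k).not_isDiag_of_mem_edgeFinset ht

theorem mem_octahedralEdges [DecidableEq V] {e : Fin (k + 1) × Fin 2 ↪ V}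
    {a b : Fin (k + 1) × Fin 2} :
    s(e a, e b) ∈ octahedralEdges e ↔ a.1 ≠ b.1 := by
  rw [octahedralEdges, ← Sym2.map_mk, Finset.mem_image]
  simp only [(Sym2.map.injective e.injective).eq_iff]
  rw [exists_eq_right, mem_edgeFinset]
  rfl

theorem octahedralEdges_subset_edgeSet [DecidableEq V] {e : Fin (k + 1) × Fin 2 ↪ V}
    {G : SimpleGraph V} :
    (octahedralEdges e : Set (Sym2 V)) ⊆ G.edgeSet ↔ ∀ a b, a.1 ≠ b.1 → G.Adj (e a) (e b) := by
  constructor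
  · intro h a b hab
    exact h (Finset.mem_coe.2 (mem_octahedralEdges.2 hab))
  · intro h s hs
    obtain ⟨t, ht, rfl⟩ := Finset.mem_image.1 (Finset.mem_coe.1 hs)
    induction t with
    | h a b =>
      rw [mem_edgeFinset] at ht
      exact h a b ht

theorem mem_range_of_mem_octahedralEdges [DecidableEq V] {e : Fin (k + 1) × Fin 2 ↪ V} {s : Sym2 V}
    (hs : s ∈ octahedralEdges e) {x : V} (hx : x ∈ s) : x ∈ Set.range e := by
  obtain ⟨t, -, rfl⟩ := Finset.mem_image.1 hs
  obtain ⟨a, -, rfl⟩ := Sym2.mem_map.1 hx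
  exact ⟨a, rfl⟩

/-- Two copies whose common vertices play the same role in both have at most `k` common edges per
common vertex. -/
theorem card_inter_octahedralEdges_le [DecidableEq V] {e e' : Fin (k + 1) × Fin 2 ↪ V}
    (h : ∀ a b, e a = e' b → a = b) :
    (octahedralEdges e ∩ octahedralEdges e').card ≤
      k * (Finset.univ.filter fun a => e a = e' a).card := by
  refine le_trans ?_ (card_edgeFinset_filter_octahedralGraph_le _)
  refine le_trans (Finset.card_le_card (t := Finset.image (Sym2.map e) _) ?_) Finset.card_image_le
  intro s hs
  obtain ⟨h1, h2⟩ := Finset.mem_inter.1 hs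
  obtain ⟨t, ht, rfl⟩ := Finset.mem_image.1 h1
  refine Finset.mem_image_of_mem _ (Finset.mem_filter.2 ⟨ht, fun a ha => ?_⟩)
  obtain ⟨b, hb⟩ := mem_range_of_mem_octahedralEdges h2 (Sym2.mem_map.2 ⟨a, ha, rfl⟩)
  have hab := h a b hb.symm
  rw [Finset.mem_filter]
  exact ⟨Finset.mem_univ _, by rw [← hb, hab]⟩

/-- The pair probability loses a factor `p ^ k` at most for each common vertex. -/
theorem pow_card_union_octahedralEdges_le [DecidableEq V] {e e' : Fin (k + 1) × Fin 2 ↪ V}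
    (h : ∀ a b, e a = e' b → a = b) {p : ℝ} (hp0 : 0 ≤ p) (hp1 : p ≤ 1) (hpk : 0 < p ^ k) :
    p ^ (octahedralEdges e ∪ octahedralEdges e').card ≤
      (p ^ (octahedralGraph k).edgeFinset.card) ^ 2 *
        ∏ a, if e a = e' a then (p ^ k)⁻¹ else 1 := by
  rw [Finset.prod_ite, Finset.prod_const, Finset.prod_const_one, mul_one, inv_pow,
    ← div_eq_mul_inv, le_div_iff₀ (pow_pos hpk _), ← pow_mul, ← pow_mul]
  have hc := Finset.card_union_add_card_inter (octahedralEdges e) (octahedralEdges e')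
  rw [card_octahedralEdges, card_octahedralEdges] at hc
  calc _ ≤ p ^ (octahedralEdges e ∪ octahedralEdges e').card *
        p ^ (octahedralEdges e ∩ octahedralEdges e').card := by
        refine mul_le_mul_of_nonneg_left ?_ (pow_nonneg hp0 _)
        exact pow_le_pow_of_le_one hp0 hp1 (card_inter_octahedralEdges_le h)
    _ = _ := by rw [← pow_add, hc, mul_two]

/-- The copy is not induced, or it has a cone over one of its facets. -/
def OctahedronSpoilt (G : SimpleGraph V) (e : Fin (k + 1) × Fin 2 ↪ V) : Prop :=
  (∃ i, G.Adj (e (i, 0)) (e (i, 1))) ∨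
    ∃ x, x ∉ Set.range e ∧ ∃ c : Fin (k + 1) → Fin 2, ∀ i, G.Adj x (e (i, c i))

theorem isConeFreeOctahedron_of_not_spoilt {G : SimpleGraph V} {e : Fin (k + 1) × Fin 2 ↪ V}
    (h : ∀ a b, a.1 ≠ b.1 → G.Adj (e a) (e b)) (hs : ¬ OctahedronSpoilt G e) :
    PreAbstractSimplicialComplex.IsConeFreeOctahedron G e := by
  rw [OctahedronSpoilt, not_or] at hs
  obtain ⟨hs1, hs2⟩ := hs
  refine ⟨fun a b => ⟨?_, h a b⟩, fun x hx => ?_⟩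
  · obtain ⟨i, a⟩ := a
    obtain ⟨j, b⟩ := b
    rintro hadj (rfl : i = j)
    have h01 := fun h => hs1 ⟨i, h⟩
    fin_cases a <;> fin_cases b
    · exact G.loopless.irrefl _ hadj
    · exact h01 hadj
    · exact h01 hadj.symm
    · exact G.loopless.irrefl _ hadj
  · by_contra! hc
    choose c hc using hc
    exact hs2 ⟨x, hx, c, hc⟩

/-- Given a copy of the octahedral graph, each antipodal pair is joined with probability `p`, and
each cone over one of the `2 ^ (k + 1)` facets is present with probability `p ^ (k + 1)`. -/
theorem binomialRandom_real_spoilt_le [DecidableEq V] [Fintype V] (p : unitInterval)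
    (e : Fin (k + 1) × Fin 2 ↪ V) :
    (binomialRandom V p).real ({G | (octahedralEdges e : Set (Sym2 V)) ⊆ G.edgeSet} ∩
      {G | OctahedronSpoilt G e}) ≤
      ((k + 1) * p + 2 ^ (k + 1) * (p ^ (k + 1) * Fintype.card V)) *
        (p : ℝ) ^ (octahedralGraph k).edgeFinset.card := by
  classical
  set E := (octahedralGraph k).edgeFinset.card
  let P : Fin (k + 1) → Finset (Sym2 V) := fun i =>
    octahedralEdges e ∪ {s(e (i, 0), e (i, 1))}
  let C : {x // x ∉ Set.range e} × (Fin (k + 1) → Fin 2) → Finset (Sym2 V) := fun xc =>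
    octahedralEdges e ∪ Finset.univ.image fun i => s(xc.1.1, e (i, xc.2 i))
  have hsub : {G | (octahedralEdges e : Set (Sym2 V)) ⊆ G.edgeSet} ∩ {G | OctahedronSpoilt G e} ⊆
      (⋃ i, {G | (P i : Set (Sym2 V)) ⊆ G.edgeSet}) ∪
        ⋃ xc, {G | (C xc : Set (Sym2 V)) ⊆ G.edgeSet} := by
    rintro G ⟨hG, ⟨i, hi⟩ | ⟨x, hx, c, hc⟩⟩
    · refine Or.inl (Set.mem_iUnion.2 ⟨i, ?_⟩)
      simp only [P, Finset.coe_union, Finset.coe_singleton]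
      exact Set.union_subset hG (Set.singleton_subset_iff.2 hi)
    · refine Or.inr (Set.mem_iUnion.2 ⟨⟨⟨x, hx⟩, c⟩, ?_⟩)
      simp only [C, Finset.coe_union, Finset.coe_image, Finset.coe_univ, Set.image_univ]
      refine Set.union_subset hG ?_
      rintro _ ⟨i, rfl⟩
      exact hc i
  have hP : ∀ i, (binomialRandom V p).real {G | (P i : Set (Sym2 V)) ⊆ G.edgeSet} =
      (p : ℝ) ^ (E + 1) := fun i => by
    rw [binomialRandom_real_subset_edgeSet, Finset.card_union_of_disjoint, card_octahedralEdges,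
      Finset.card_singleton]
    · rw [Finset.disjoint_singleton_right, mem_octahedralEdges]
      simp
    · intro s hs
      rcases Finset.mem_union.1 hs with hs | hs
      · exact not_isDiag_of_mem_octahedralEdges hs
      · rw [Finset.mem_singleton.1 hs]
        simp
  have hC : ∀ xc, (binomialRandom V p).real {G | (C xc : Set (Sym2 V)) ⊆ G.edgeSet} =
      (p : ℝ) ^ (E + (k + 1)) := fun ⟨⟨x, hx⟩, c⟩ => by
    rw [binomialRandom_real_subset_edgeSet, Finset.card_union_of_disjoint, card_octahedralEdges,
      Finset.card_image_of_injective, Finset.card_fin]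
    · intro i j hij
      have := e.injective (Sym2.congr_right.1 hij)
      exact congrArg Prod.fst this
    · rw [Finset.disjoint_right]
      intro s hs hs'
      obtain ⟨i, -, rfl⟩ := Finset.mem_image.1 hs
      exact hx (mem_range_of_mem_octahedralEdges hs' (Sym2.mem_mk_left _ _))
    · intro s hs
      rcases Finset.mem_union.1 hs with hs | hs
      · exact not_isDiag_of_mem_octahedralEdges hs
      · obtain ⟨i, -, rfl⟩ := Finset.mem_image.1 hs
        rw [Sym2.mk_isDiag_iff]
        exact fun h => hx ⟨_, h.symm⟩
  have hcard : (Fintype.card {x // x ∉ Set.range e} : ℝ) ≤ Fintype.card V :=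
    Nat.cast_le.2 (Fintype.card_subtype_le _)
  have hp0 : (0 : ℝ) ≤ p := p.2.1
  calc _ ≤ _ := measureReal_mono hsub
    _ ≤ _ := measureReal_union_le _ _
    _ ≤ _ := add_le_add (measureReal_iUnion_fintype_le _) (measureReal_iUnion_fintype_le _)
    _ = (k + 1) * (p : ℝ) ^ (E + 1) +
        Fintype.card {x // x ∉ Set.range e} * 2 ^ (k + 1) * (p : ℝ) ^ (E + (k + 1)) := by
      simp [hP, hC]
    _ ≤ (k + 1) * (p : ℝ) ^ (E + 1) + Fintype.card V * 2 ^ (k + 1) * (p : ℝ) ^ (E + (k + 1)) := by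
      gcongr
    _ = _ := by ring

/-- Second moment estimate. The copies counted have their vertex `a` in the `a`-th of `2 (k + 1)`
disjoint classes of `m` vertices, so that common vertices of two copies play the same role. -/
theorem one_sub_le_binomialRandom_real_exists_isConeFreeOctahedron [Fintype V] {m : ℕ}
    (hm : 0 < m) (hmV : 2 * (k + 1) * m ≤ Fintype.card V) (p : unitInterval)
    (hpk : 0 < (p : ℝ) ^ k) :
    1 - 4 * ((1 + ((p : ℝ) ^ k * m)⁻¹) ^ (2 * (k + 1)) - 1) -
        2 * ((k + 1) * p + 2 ^ (k + 1) * (p ^ (k + 1) * Fintype.card V)) ≤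
      (binomialRandom V p).real
        {G | ∃ e : Fin (k + 1) × Fin 2 ↪ V,
          PreAbstractSimplicialComplex.IsConeFreeOctahedron G e} := by
  classical
  have := measurableSingletonClass (V := V)
  have hcard : Fintype.card (Fin (k + 1) × Fin 2) = 2 * (k + 1) := by simp [mul_comm]
  obtain ⟨emb⟩ : Nonempty ((Fin (k + 1) × Fin 2) × Fin m ↪ V) :=
    Function.Embedding.nonempty_of_card_le (by rwa [Fintype.card_prod, hcard, Fintype.card_fin])
  let e : (Fin (k + 1) × Fin 2 → Fin m) → Fin (k + 1) × Fin 2 ↪ V := fun f =>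
    ⟨fun a => emb (a, f a), fun a b hab => congrArg Prod.fst (emb.injective hab)⟩
  have he : ∀ f g a b, e f a = e g b → a = b := fun f g a b hab =>
    congrArg Prod.fst (emb.injective hab)
  have he' : ∀ f g a, e f a = e g a ↔ f a = g a := fun f g a =>
    emb.injective.eq_iff.trans (by simp)
  set E := (octahedralGraph k).edgeFinset.card
  have hp0 : (0 : ℝ) ≤ p := p.2.1
  have hp1 : (p : ℝ) ≤ 1 := p.2.2
  have hm' : (0 : ℝ) < m := Nat.cast_pos.2 hm
  have hE : (0 : ℝ) < (p : ℝ) ^ E := by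
    have hEk : E ≤ k * (2 * (k + 1)) := by
      have := card_edgeFinset_filter_octahedralGraph_le
        (Finset.univ : Finset (Fin (k + 1) × Fin 2))
      rwa [Finset.filter_true_of_mem (by simp), Finset.card_univ, hcard] at this
    refine lt_of_lt_of_le ?_ (pow_le_pow_of_le_one hp0 hp1 hEk)
    rw [pow_mul]
    exact pow_pos hpk _
  set A : (Fin (k + 1) × Fin 2 → Fin m) → Set (SimpleGraph V) := fun f =>
    {G | (octahedralEdges (e f) : Set (Sym2 V)) ⊆ G.edgeSet}
  set B : (Fin (k + 1) × Fin 2 → Fin m) → Set (SimpleGraph V) := fun f =>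
    {G | OctahedronSpoilt G (e f)}
  have hA : ∀ f, (binomialRandom V p).real (A f) = (p : ℝ) ^ E := fun f => by
    rw [binomialRandom_real_subset_edgeSet p fun _ => not_isDiag_of_mem_octahedralEdges,
      card_octahedralEdges]
  have hAA : ∀ f g, (binomialRandom V p).real (A f ∩ A g) ≤
      ((p : ℝ) ^ E) ^ 2 * ∏ a, if f a = g a then ((p : ℝ) ^ k)⁻¹ else 1 := fun f g => by
    have hinter : A f ∩ A g =
        {G | ((octahedralEdges (e f) ∪ octahedralEdges (e g) : Finset (Sym2 V)) : Set (Sym2 V)) ⊆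
          G.edgeSet} := by
      ext G
      simp [A, Set.union_subset_iff]
    rw [hinter, binomialRandom_real_subset_edgeSet]
    · refine (pow_card_union_octahedralEdges_le (he f g) hp0 hp1 hpk).trans_eq ?_
      simp only [he', E]
    · intro s hs
      rcases Finset.mem_union.1 hs with hs | hs <;> exact not_isDiag_of_mem_octahedralEdges hs
  have hsum : ∀ f : Fin (k + 1) × Fin 2 → Fin m,
      ∑ g : Fin (k + 1) × Fin 2 → Fin m, ∏ a, (if f a = g a then ((p : ℝ) ^ k)⁻¹ else 1) ≤
        (m + ((p : ℝ) ^ k)⁻¹) ^ (2 * (k + 1)) := fun f => by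
    rw [← Fintype.piFinset_univ, ← Finset.prod_univ_sum (fun _ => Finset.univ)
      fun a c => if f a = c then ((p : ℝ) ^ k)⁻¹ else 1, ← hcard, ← Finset.card_univ,
      ← Finset.prod_const]
    refine Finset.prod_le_prod (fun a _ => Finset.sum_nonneg fun c _ => ?_) fun a _ => ?_
    · split_ifs <;> positivity
    · calc ∑ c, (if f a = c then ((p : ℝ) ^ k)⁻¹ else 1)
          ≤ ∑ c : Fin m, (1 + if f a = c then ((p : ℝ) ^ k)⁻¹ else 0) := by
            refine Finset.sum_le_sum fun c _ => ?_
            split_ifs <;> simp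
        _ = m + ((p : ℝ) ^ k)⁻¹ := by simp [Finset.sum_add_distrib]
  have hcount : Fintype.card (Fin (k + 1) × Fin 2 → Fin m) = m ^ (2 * (k + 1)) := by
    rw [Fintype.card_fun, hcard, Fintype.card_fin]
  refine (one_sub_le_measureReal_iUnion_diff (binomialRandom V p) A B
    (N := (m : ℝ) ^ (2 * (k + 1)) * (p : ℝ) ^ E) (by positivity) ?_ ?_ ?_).trans
    (measureReal_mono ?_)
  · simp only [hA, Finset.sum_const, Finset.card_univ, hcount, nsmul_eq_mul, Nat.cast_pow]
  · calc ∑ f, ∑ g, (binomialRandom V p).real (A f ∩ A g)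
        ≤ ∑ _f : Fin (k + 1) × Fin 2 → Fin m,
          ((p : ℝ) ^ E) ^ 2 * (m + ((p : ℝ) ^ k)⁻¹) ^ (2 * (k + 1)) := by
          refine Finset.sum_le_sum fun f _ => (Finset.sum_le_sum fun g _ => hAA f g).trans ?_
          rw [← Finset.mul_sum]
          exact mul_le_mul_of_nonneg_left (hsum f) (by positivity)
      _ = (m : ℝ) ^ (2 * (k + 1)) * (((p : ℝ) ^ E) ^ 2 *
          (m * (1 + ((p : ℝ) ^ k * m)⁻¹)) ^ (2 * (k + 1))) := by
          rw [Finset.sum_const, Finset.card_univ, hcount, nsmul_eq_mul, Nat.cast_pow]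
          congr 4
          field_simp
      _ = _ := by rw [mul_pow]; ring
  · calc ∑ f, (binomialRandom V p).real (A f ∩ B f)
        ≤ ∑ _f : Fin (k + 1) × Fin 2 → Fin m, _ :=
          Finset.sum_le_sum fun f _ => binomialRandom_real_spoilt_le p (e f)
      _ = _ := by
          rw [Finset.sum_const, Finset.card_univ, hcount, nsmul_eq_mul, Nat.cast_pow]
          ring
  · intro G hG
    obtain ⟨f, hf, hf'⟩ := Set.mem_iUnion.1 hG
    exact ⟨e f, isConeFreeOctahedron_of_not_spoilt (octahedralEdges_subset_edgeSet.1 hf) hf'⟩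

end SimpleGraph

/-! ### Almost always properties -/

theorem AlmostAlways.mono {p : ℕ → unitInterval} {P Q : ∀ n : ℕ, SimpleGraph (Fin n) → Prop}
    (hP : AlmostAlways p P) (h : ∀ n G, P n G → Q n G) : AlmostAlways p Q :=
  tendsto_of_tendsto_of_tendsto_of_le_of_le hP tendsto_const_nhds
    (fun n => measure_mono fun G hG => h n G hG) fun _ => prob_le_one

theorem almostAlways_of_le_measureReal {p : ℕ → unitInterval}
    {P : ∀ n : ℕ, SimpleGraph (Fin n) → Prop} {a : ℕ → ℝ} (ha : Tendsto a atTop (𝓝 1))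
    (h : ∀ᶠ n in atTop, a n ≤ (SimpleGraph.binomialRandom (Fin n) (p n)).real {G | P n G}) :
    AlmostAlways p P := by
  have hr : Tendsto (fun n => (SimpleGraph.binomialRandom (Fin n) (p n)).real {G | P n G}) atTop
      (𝓝 1) :=
    tendsto_of_tendsto_of_tendsto_of_le_of_le' ha tendsto_const_nhds h
      (Eventually.of_forall fun _ => measureReal_le_one)
  have := ENNReal.tendsto_ofReal hr
  rw [ENNReal.ofReal_one] at this
  refine this.congr fun n => ?_
  exact ofReal_measureReal

theorem tendsto_zero_of_pow_mul_natCast_tendsto_zero {p : ℕ → unitInterval} {k : ℕ}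
    (h : Tendsto (fun n : ℕ => (p n : ℝ) ^ (k + 1) * n) atTop (𝓝 0)) :
    Tendsto (fun n => (p n : ℝ)) atTop (𝓝 0) := by
  refine squeeze_zero' (Eventually.of_forall fun n => (p n).2.1) ?_
    (g := fun n : ℕ => ((p n : ℝ) ^ (k + 1) * n) ^ ((k : ℝ) + 1)⁻¹) ?_
  · filter_upwards [eventually_ge_atTop 1] with n hn
    have h0 : (0 : ℝ) ≤ p n := (p n).2.1
    have hn : (1 : ℝ) ≤ n := Nat.one_le_cast.2 hn
    calc (p n : ℝ) = ((p n : ℝ) ^ (k + 1)) ^ ((k : ℝ) + 1)⁻¹ := by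
          have := Real.pow_rpow_inv_natCast h0 k.succ_ne_zero
          push_cast at this
          exact this.symm
      _ ≤ _ := by
          refine Real.rpow_le_rpow (pow_nonneg h0 _) ?_ (by positivity)
          exact le_mul_of_one_le_right (pow_nonneg h0 _) hn
  · have := h.rpow_const (p := ((k : ℝ) + 1)⁻¹) (Or.inr (by positivity))
    rwa [Real.zero_rpow (by positivity)] at this

theorem almostAlways_exists_isConeFreeOctahedron (k : ℕ) (p : ℕ → unitInterval)
    (hp₁ : Tendsto (fun n : ℕ => (p n : ℝ) ^ (k + 1) * n) atTop (𝓝 0))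
    (hp₂ : Tendsto (fun n : ℕ => (p n : ℝ) ^ k * n) atTop atTop) :
    AlmostAlways p fun n G => ∃ e : Fin (k + 1) × Fin 2 ↪ Fin n,
      PreAbstractSimplicialComplex.IsConeFreeOctahedron G e := by
  have hp := tendsto_zero_of_pow_mul_natCast_tendsto_zero hp₁
  let m : ℕ → ℕ := fun n => n / (2 * (k + 1))
  have hm : ∀ n, 2 * (k + 1) ≤ n → 0 < m n ∧ (n : ℝ) ≤ 4 * (k + 1) * m n := fun n hn => by
    have h1 : 0 < m n := Nat.div_pos hn (by positivity)
    have h2 : n < 2 * (k + 1) * (m n + 1) := Nat.lt_mul_div_succ n (by positivity)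
    refine ⟨h1, ?_⟩
    have h3 : n ≤ 4 * (k + 1) * m n := by nlinarith
    exact_mod_cast h3
  have hpm : Tendsto (fun n => (p n : ℝ) ^ k * m n) atTop atTop := by
    refine tendsto_atTop_mono' atTop ?_
      (hp₂.const_mul_atTop (show (0 : ℝ) < (4 * ((k : ℝ) + 1))⁻¹ by positivity))
    filter_upwards [eventually_ge_atTop (2 * (k + 1))] with n hn
    have h0 : (0 : ℝ) ≤ (p n : ℝ) ^ k := pow_nonneg (p n).2.1 _
    rw [inv_mul_le_iff₀ (by positivity)]
    calc (p n : ℝ) ^ k * n ≤ (p n : ℝ) ^ k * (4 * (k + 1) * m n) :=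
          mul_le_mul_of_nonneg_left (hm n hn).2 h0
      _ = _ := by ring
  refine almostAlways_of_le_measureReal (a := fun n =>
    1 - 4 * ((1 + ((p n : ℝ) ^ k * m n)⁻¹) ^ (2 * (k + 1)) - 1) -
      2 * ((k + 1) * p n + 2 ^ (k + 1) * ((p n : ℝ) ^ (k + 1) * n))) ?_ ?_
  · have h1 := (((hpm.inv_tendsto_atTop.const_add 1).pow (2 * (k + 1))).sub_const 1).const_mul 4
    have h2 := ((hp.const_mul ((k : ℝ) + 1)).add (hp₁.const_mul (2 ^ (k + 1)))).const_mul 2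
    have h3 := (h1.const_sub 1).sub h2
    simpa using h3
  · filter_upwards [eventually_ge_atTop (2 * (k + 1)), hpm.eventually_gt_atTop 0] with n hn hn'
    have hpk : (0 : ℝ) < (p n : ℝ) ^ k :=
      (pow_nonneg (p n).2.1 _).lt_of_ne fun h => by simp [← h] at hn'
    have := SimpleGraph.one_sub_le_binomialRandom_real_exists_isConeFreeOctahedron (V := Fin n)
      (hm n hn).1 (by rw [Fintype.card_fin]; exact Nat.mul_div_le _ _) (p n) hpk
    rwa [Fintype.card_fin] at this

theorem theorem3p5 (k : ℕ) (p : ℕ → unitInterval)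
    (hp₁ : Tendsto (fun n : ℕ => (p n : ℝ) ^ (k + 1) * n) atTop (𝓝 0))
    (hp₂ : Tendsto (fun n : ℕ => (p n : ℝ) ^ k * n) atTop atTop) :
    AlmostAlways p (fun _ G => G.cliqueComplex.RetractsOntoOctahedralSphere k) ∧
    AlmostAlways p (fun _ G => HasIntSummand (G.cliqueComplex.ReducedHomology k)) := by
  have h := (almostAlways_exists_isConeFreeOctahedron k p hp₁ hp₂).mono
    (Q := fun _ G => G.cliqueComplex.RetractsOntoOctahedralSphere k)
    fun n G ⟨e, he⟩ => he.retractsOntoOctahedralSphere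
  exact ⟨h, h.mono fun n G hG => hG.hasIntSummand⟩
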